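/- Let $\sigma>0$, let $H_\sigma(w)=e^{-2\pi^2\sigma^2w^2}$, and let $f:\mathbb{R}\to\mathbb{R}$ be bounded, measurable and differentiable. Let $\tilde f$ be the Fourier smoothing of $f$ with parameter $\sigma$: the Fourier transform of $f$ is multiplied by the Gaussian low-pass filter $H_\sigma$ and transformed back, that is, $$\tilde f(x)=\int_{\mathbb{R}} f(y)\Big(\int_{\mathbb{R}}H_\sigma(w)\,e^{2\pi i(x-y)w}\,dw\Big)dy ,$$ which equals $\int_{\mathbb{R}}H_\sigma(w)\,\big(\int_{\mathbb{R}} f(y)e^{-2\pi i yw}dy\big)\,e^{2\pi i xw}\,dw$ when $f$ is integrable. Let $t\in\mathbb{R}$ be such that $f$ is not identically equal to $t$, and let $A_t=\{x: f(x)=t,\ f'(x)\neq 0\}$. Assume that $A_t$ is finite and that $f$ does not pass from one side of the level $t$ to the other without meeting $A_t$: whenever $a<b$ and $(f(a)-t)(f(b)-t)<0$, there is a point of $A_t$ in $(a,b)$. (This holds in particular if $f'(x)\ne 0$ at every $x$ with $f(x)=t$.) Let $B_t=\{x:\tilde f(x)=t\}$. Then: 1. $B_t$ is finite and $\#B_t\le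 \#A_t$; consequently the number of connected components (disconnected intervals) of $B_t$ is at most that of $A_t$. 2. The number of disconnected intervals of the prediction set does not increase after smoothing: the number of connected components of $\{x:\tilde f(x)\ge t\}$ is at most the number of connected components of $\{x: f(x)\ge t\}$. -/

import Mathlib

open MeasureTheory
open scoped FourierTransform

/-- The Gaussian low-pass filter `H_σ(w) = exp (-2 π² σ² w²)`. -/
noncomputable def gaussianLowPass (σ w : ℝ) : ℝ :=
  Real.exp (-2 * Real.pi ^ 2 * σ ^ 2 * w ^ 2)

/-- The inverse Fourier transform `K_σ(s) = ∫ H_σ(w) e^{2πisw} dw` of the low-pass filter. -/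
noncomputable def smoothingKernel (σ s : ℝ) : ℂ :=
  ∫ w : ℝ, (gaussianLowPass σ w : ℂ) * Complex.exp (2 * Real.pi * Complex.I * s * w)

/-- Fourier smoothing of `f` with parameter `σ`: multiply the Fourier transform of `f` by `H_σ` and
transform back. So that this makes sense for every bounded measurable `f`, integrable or not, the
frequency integral is carried out first:
`f̃(x) = ∫ f(y) (∫ H_σ(w) e^{2πi(x-y)w} dw) dy`.
This is the pairing of the distributional Fourier transform of `f` with the Schwartz function
`w ↦ H_σ(w) e^{2πixw}`. For integrable `f` it is the inverse Fourier integral of `H_σ · 𝓕 f`, see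
`fourierInv_lowPass_mul_fourier`; the value is real, so taking the real part loses nothing. -/
noncomputable def fourierSmoothing (σ : ℝ) (f : ℝ → ℝ) (x : ℝ) : ℝ :=
  (∫ y : ℝ, (f y : ℂ) * smoothingKernel σ (x - y)).re

/-- `A_t`: the points where `f` crosses the level `t` with nonzero derivative. -/
def crossingSet (f : ℝ → ℝ) (t : ℝ) : Set ℝ :=
  {x | f x = t ∧ deriv f x ≠ 0}

/-- The level set `{x : g(x) = t}`. -/
def levelSet (g : ℝ → ℝ) (t : ℝ) : Set ℝ :=
  {x | g x = t}

/-- The prediction set `{x : g(x) ≥ t}` with threshold `t`. -/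
def predictionSet (g : ℝ → ℝ) (t : ℝ) : Set ℝ :=
  {x | t ≤ g x}

/-- The number of disconnected intervals of a subset of the line, that is, of its connected
components (`⊤` if there are infinitely many). -/
noncomputable def intervalCount (S : Set ℝ) : ℕ∞ :=
  ENat.card (ConnectedComponents S)

theorem integrable_gaussianLowPass {σ : ℝ} (hσ : 0 < σ) :
    Integrable (fun w : ℝ => (gaussianLowPass σ w : ℂ)) := by
  have h : Integrable (fun w : ℝ => Real.exp (-(2 * Real.pi ^ 2 * σ ^ 2) * w ^ 2)) :=
    integrable_exp_neg_mul_sq (by positivity)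
  refine Integrable.ofReal (f := gaussianLowPass σ) (h.congr (Filter.Eventually.of_forall fun w => ?_))
  have hw : -(2 * Real.pi ^ 2 * σ ^ 2) * w ^ 2 = -2 * Real.pi ^ 2 * σ ^ 2 * w ^ 2 := by ring
  change Real.exp _ = Real.exp _
  rw [hw]

theorem smoothingKernel_conj (σ s : ℝ) :
    (starRingEnd ℂ) (smoothingKernel σ s) = smoothingKernel σ s := by
  unfold smoothingKernel
  rw [← integral_conj]
  rw [← integral_neg_eq_self
    (fun w : ℝ => (gaussianLowPass σ w : ℂ) * Complex.exp (2 * Real.pi * Complex.I * s * w))]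
  congr 1
  funext w
  have hconj : (starRingEnd ℂ) (2 : ℂ) = 2 := Complex.conj_ofNat 2
  rw [map_mul, Complex.conj_ofReal, ← Complex.exp_conj]
  simp [hconj, gaussianLowPass]

theorem fourierSmoothing_coe (σ : ℝ) (f : ℝ → ℝ) (x : ℝ) :
    (fourierSmoothing σ f x : ℂ) = ∫ y : ℝ, (f y : ℂ) * smoothingKernel σ (x - y) := by
  unfold fourierSmoothing
  rw [← Complex.conj_eq_iff_re, ← integral_conj]
  congr 1
  funext y
  rw [map_mul, Complex.conj_ofReal, smoothingKernel_conj]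

/-- For integrable `f`, Fourier smoothing is literally: Fourier transform, multiplication by the
low-pass filter, inverse Fourier transform. -/
theorem fourierInv_lowPass_mul_fourier {σ : ℝ} (hσ : 0 < σ) {f : ℝ → ℝ} (hf : Integrable f)
    (x : ℝ) :
    𝓕⁻ (fun w : ℝ => 𝓕 (fun y : ℝ => (f y : ℂ)) w * (gaussianLowPass σ w : ℂ)) x
      = (fourierSmoothing σ f x : ℂ) := by
  rw [fourierSmoothing_coe, Real.fourierInv_eq']
  simp only [Real.fourier_eq', smoothingKernel]
  have hint : Integrable (fun p : ℝ × ℝ => ((gaussianLowPass σ p.1 : ℂ) * (f p.2 : ℂ)) *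
      Complex.exp (2 * Real.pi * Complex.I * ((x - p.2 : ℝ) : ℂ) * p.1))
      (volume.prod volume) := by
    refine ((integrable_gaussianLowPass hσ).mul_prod hf.ofReal).mul_bdd (c := 1) ?_ ?_
    · exact Continuous.aestronglyMeasurable (by fun_prop)
    · refine Filter.Eventually.of_forall fun p => ?_
      rw [Complex.norm_exp]
      simp
  calc _ = ∫ w : ℝ, ∫ y : ℝ, ((gaussianLowPass σ w : ℂ) * (f y : ℂ)) *
      Complex.exp (2 * Real.pi * Complex.I * ((x - y : ℝ) : ℂ) * w) := by
        congr 1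
        funext w
        rw [smul_eq_mul, mul_comm, mul_assoc, ← integral_mul_const]
        congr 1
        funext y
        rw [smul_eq_mul]
        simp only [RCLike.inner_apply, conj_trivial]
        have hexp : Complex.exp (2 * Real.pi * Complex.I * ((x - y : ℝ) : ℂ) * w)
            = Complex.exp (((-2 * Real.pi * (w * y) : ℝ) : ℂ) * Complex.I)
              * Complex.exp (((2 * Real.pi * (x * w) : ℝ) : ℂ) * Complex.I) := by
          rw [← Complex.exp_add]
          congr 1
          push_cast
          ring
        rw [hexp]
        push_cast
        ring_nf
    _ = ∫ y : ℝ, ∫ w : ℝ, ((gaussianLowPass σ w : ℂ) * (f y : ℂ)) *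
      Complex.exp (2 * Real.pi * Complex.I * ((x - y : ℝ) : ℂ) * w) := integral_integral_swap hint
    _ = _ := by
        congr 1
        funext y
        rw [← integral_const_mul]
        congr 1
        funext w
        ring

/-! Smoothing is convolution with a normal density. Expanding `(x - y) ^ 2` shows that `f̃ x - t` is
a positive factor times the Laplace transform, at `x / σ ^ 2`, of `h y = (f y - t) * exp (-y ^ 2 /
(2 * σ ^ 2))` (`exists_fourierSmoothing_sub_eq`). So the theorem is Descartes' rule of signs for
Laplace transforms. If `h` changes sign at `a`, then `(y - a) * h y` has one sign change fewer, and
its transform is, up to an exponential, the derivative of `exp (-a * x)` times the transform of `h`.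
By Rolle, one sign change pays for at most one zero, and without sign changes the transform never
vanishes. This bounds the zeros (`card_zeros_twoSidedLaplace_le`).

For prediction sets the same induction is run on sign patterns
(`le_length_of_twoSidedLaplace_alternates`). Having at least `n + 1` components means having `2 * n
+ 1` increasing points alternately inside and outside the set. Such a chain for `f̃` forces `2 * n`
crossings of `f`, with matching signs if there are no more than that, and the crossings of `f`
supply a chain for `f`. -/

/-! ### Descartes' rule of signs for the two-sided Laplace transform. -/

section TwoSidedLaplace

/-- The two-sided Laplace transform `∫ h(y) e^{xy} dy`. -/
noncomputable def twoSidedLaplace (h : ℝ → ℝ) (x : ℝ) : ℝ :=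
  ∫ y : ℝ, h y * Real.exp (x * y)

/-- Continuous functions whose two-sided Laplace transform converges absolutely everywhere. -/
structure LaplaceAdmissible (h : ℝ → ℝ) : Prop where
  continuous : Continuous h
  integrable : ∀ x : ℝ, Integrable fun y : ℝ => h y * Real.exp (x * y)

theorem abs_le_exp_add_exp_neg (y : ℝ) : |y| ≤ Real.exp y + Real.exp (-y) := by
  have h1 := Real.add_one_le_exp y
  have h2 := Real.add_one_le_exp (-y)
  have h3 := Real.exp_pos y
  have h4 := Real.exp_pos (-y)
  rcases abs_cases y with ⟨h, _⟩ | ⟨h, _⟩ <;> rw [h] <;> linarith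

/-- The factor `|y|` is absorbed by moving `x` to `x + 1` and `x - 1`, where integrability is known
too. -/
theorem LaplaceAdmissible.id_mul {h : ℝ → ℝ} (hh : LaplaceAdmissible h) :
    LaplaceAdmissible fun y => y * h y := by
  refine ⟨continuous_id.mul hh.continuous, fun x => ?_⟩
  have hc := hh.continuous
  refine Integrable.mono' ((hh.integrable (x + 1)).norm.add (hh.integrable (x - 1)).norm)
    (Continuous.aestronglyMeasurable (by fun_prop)) (Filter.Eventually.of_forall fun y => ?_)
  have h1 : Real.exp ((x + 1) * y) = Real.exp (x * y) * Real.exp y := by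
    rw [← Real.exp_add]; ring_nf
  have h2 : Real.exp ((x - 1) * y) = Real.exp (x * y) * Real.exp (-y) := by
    rw [← Real.exp_add]; ring_nf
  simp only [Pi.add_apply, norm_mul, Real.norm_eq_abs, Real.abs_exp, h1, h2]
  have h3 := mul_le_mul_of_nonneg_left (abs_le_exp_add_exp_neg y)
    (show 0 ≤ |h y| * Real.exp (x * y) by positivity)
  linarith

theorem LaplaceAdmissible.sub_mul {h : ℝ → ℝ} (hh : LaplaceAdmissible h) (a : ℝ) :
    LaplaceAdmissible fun y => (y - a) * h y := by
  refine ⟨(continuous_id.sub continuous_const).mul hh.continuous, fun x => ?_⟩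
  refine ((hh.id_mul.integrable x).sub ((hh.integrable x).const_mul a)).congr
    (Filter.Eventually.of_forall fun y => ?_)
  simp only [Pi.sub_apply]
  ring

theorem twoSidedLaplace_sub_mul {h : ℝ → ℝ} (hh : LaplaceAdmissible h) (a x : ℝ) :
    twoSidedLaplace (fun y => (y - a) * h y) x
      = twoSidedLaplace (fun y => y * h y) x - a * twoSidedLaplace h x := by
  unfold twoSidedLaplace
  rw [← integral_const_mul, ← integral_sub (hh.id_mul.integrable x)
    ((hh.integrable x).const_mul a)]
  congr 1
  funext y
  ring

theorem hasDerivAt_twoSidedLaplace {h : ℝ → ℝ} (hh : LaplaceAdmissible h) (x : ℝ) :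
    HasDerivAt (twoSidedLaplace h) (twoSidedLaplace (fun y => y * h y) x) x := by
  have hc := hh.continuous
  refine (hasDerivAt_integral_of_dominated_loc_of_deriv_le (Metric.ball_mem_nhds x one_pos)
    (F := fun x y => h y * Real.exp (x * y)) (F' := fun x y => y * h y * Real.exp (x * y))
    (bound := fun y => ‖y * h y * Real.exp ((x + 1) * y)‖ + ‖y * h y * Real.exp ((x - 1) * y)‖)
    (Filter.Eventually.of_forall fun z => Continuous.aestronglyMeasurable (by fun_prop))
    (hh.integrable x) (Continuous.aestronglyMeasurable (by fun_prop))
    (Filter.Eventually.of_forall fun y z hz => ?_)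
    ((hh.id_mul.integrable (x + 1)).norm.add (hh.id_mul.integrable (x - 1)).norm)
    (Filter.Eventually.of_forall fun y z _ => ?_)).2
  · rw [Metric.mem_ball, Real.dist_eq, abs_lt] at hz
    simp only [norm_mul, Real.norm_eq_abs, Real.abs_exp, ← mul_add]
    refine mul_le_mul_of_nonneg_left ?_ (by positivity)
    -- For `z` within distance 1 of `x`, the sign of `y` decides which of the two exponentials
    -- dominates.
    rcases le_total 0 y with hy | hy
    · have : Real.exp (z * y) ≤ Real.exp ((x + 1) * y) :=
        Real.exp_le_exp.2 (mul_le_mul_of_nonneg_right (by linarith) hy)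
      linarith [Real.exp_pos ((x - 1) * y)]
    · have : Real.exp (z * y) ≤ Real.exp ((x - 1) * y) :=
        Real.exp_le_exp.2 (mul_le_mul_of_nonpos_right (by linarith) hy)
      linarith [Real.exp_pos ((x + 1) * y)]
  · have h1 : HasDerivAt (fun z : ℝ => z * y) y z := by
      simpa using (hasDerivAt_id z).mul_const y
    exact (h1.exp.const_mul (h y)).congr_deriv (by ring)

/-- Multiplying `h` by `y - a` differentiates its Laplace transform, up to exponential factors. -/
theorem hasDerivAt_exp_mul_twoSidedLaplace {h : ℝ → ℝ} (hh : LaplaceAdmissible h) (a x : ℝ) :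
    HasDerivAt (fun x => Real.exp (-(a * x)) * twoSidedLaplace h x)
      (Real.exp (-(a * x)) * twoSidedLaplace (fun y => (y - a) * h y) x) x := by
  have h1 : HasDerivAt (fun x : ℝ => Real.exp (-(a * x))) (Real.exp (-(a * x)) * (-a)) x := by
    have : HasDerivAt (fun x : ℝ => -(a * x)) (-a) x := by
      simpa using (hasDerivAt_id x).const_mul (-a)
    exact this.exp
  refine (h1.mul (hasDerivAt_twoSidedLaplace hh x)).congr_deriv ?_
  rw [twoSidedLaplace_sub_mul hh]
  ring

/-- Base case of both inductions: no sign changes. Continuity turns one nonzero value into a nonzero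
integral. -/
theorem twoSidedLaplace_pos {h : ℝ → ℝ} (hh : LaplaceAdmissible h) {ε : ℝ}
    (hnonneg : ∀ y, 0 ≤ ε * h y) (hne : ∃ y, ε * h y ≠ 0) (x : ℝ) :
    0 < ε * twoSidedLaplace h x := by
  obtain ⟨y, hy⟩ := hne
  have hc := hh.continuous
  unfold twoSidedLaplace
  rw [← integral_const_mul]
  refine integral_pos_of_integrable_nonneg_nonzero (x := y) (by fun_prop)
    ((hh.integrable x).const_mul ε) (fun z => ?_) ?_
  · simp only [Pi.zero_apply, ← mul_assoc]
    exact mul_nonneg (hnonneg z) (Real.exp_pos _).le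
  · rw [← mul_assoc]
    exact mul_ne_zero hy (Real.exp_ne_zero _)

/-- Descartes' rule for the Laplace transform: if `h` changes sign only at the points of `l`, its
Laplace transform has at most `l.length` zeros. -/
theorem card_zeros_twoSidedLaplace_le (l : List ℝ) {ε : ℝ} :
    ∀ {h : ℝ → ℝ}, LaplaceAdmissible h →
    (∀ y, 0 ≤ ε * (h y * (l.map fun a => y - a).prod)) →
    (∃ y, ε * (h y * (l.map fun a => y - a).prod) ≠ 0) →
    ∀ s : Finset ℝ, (∀ x ∈ s, twoSidedLaplace h x = 0) → s.card ≤ l.length := by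
  induction l with
  | nil =>
    intro h hh hnonneg hne s hs
    have hs' : s = ∅ := Finset.eq_empty_of_forall_notMem fun x hx => by
      have := twoSidedLaplace_pos hh (by simpa using hnonneg) (by simpa using hne) x
      simp [hs x hx] at this
    simp [hs']
  | cons a l ih =>
    intro h hh hnonneg hne s hs
    -- The factor `y - a` moves from the product into the function, so the sign hypothesis persists
    -- with the same `ε`.
    have hmul : ∀ y, (y - a) * h y * (l.map fun a => y - a).prod
        = h y * ((a :: l).map fun a => y - a).prod := fun y => by
      simp only [List.map_cons, List.prod_cons]; ring
    have key := ih (hh.sub_mul a) (fun y => by rw [hmul]; exact hnonneg y)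
      (by obtain ⟨y, hy⟩ := hne; exact ⟨y, by rw [hmul]; exact hy⟩)
    -- The interleaving count needs these zeros as a `Finset`; the induction hypothesis bounds every
    -- finite subset.
    have hfin : {x | twoSidedLaplace (fun y => (y - a) * h y) x = 0}.Finite := by
      by_contra hinf
      obtain ⟨u, hu, hcard⟩ := Set.Infinite.exists_subset_card_eq hinf (l.length + 1)
      have := key u fun x hx => hu hx
      omega
    refine (Finset.card_le_of_interleaved (t := hfin.toFinset) fun x hx y hy hxy _ => ?_).trans
      (Nat.add_le_add_right (key _ fun x hx => by simpa using hx) 1)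
    obtain ⟨z, hz, hz'⟩ := exists_hasDerivAt_eq_zero hxy
      (fun z _ => (hasDerivAt_exp_mul_twoSidedLaplace hh a z).continuousAt.continuousWithinAt)
      (by simp only [hs x hx, hs y hy, mul_zero])
      (fun z _ => hasDerivAt_exp_mul_twoSidedLaplace hh a z)
    refine ⟨z, ?_, hz.1, hz.2⟩
    simpa [Real.exp_ne_zero] using hz'

/-- If the Laplace transform of `h` has `k` (weak) sign changes, starting with sign `s`, and `h`
changes sign only at the points of `l`, then `k ≤ l.length`, and in case of equality the first
signs of `h` and its transform agree. -/
theorem le_length_of_twoSidedLaplace_alternates (l : List ℝ) {ε : ℝ} :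
    ∀ {h : ℝ → ℝ}, LaplaceAdmissible h →
    (∀ y, 0 ≤ ε * (h y * (l.map fun a => y - a).prod)) →
    (∃ y, ε * (h y * (l.map fun a => y - a).prod) ≠ 0) →
    ∀ (k : ℕ) (s : ℝ) (u : ℕ → ℝ), s ≠ 0 → (∀ i < k, u i < u (i + 1)) →
    (∀ i ≤ k, 0 ≤ s * (-1) ^ i * twoSidedLaplace h (u i)) →
    (∀ i < k, twoSidedLaplace h (u i) ≠ 0 ∨ twoSidedLaplace h (u (i + 1)) ≠ 0) →
    k ≤ l.length ∧ (k = l.length → 0 < s * (-1) ^ k * ε) := by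
  induction l with
  | nil =>
    intro h hh hnonneg hne k s u hs hu hsign _
    have hpos := twoSidedLaplace_pos hh (by simpa using hnonneg) (by simpa using hne)
    have hsε : 0 < s * ε := by
      have h0 := hsign 0 (Nat.zero_le k)
      simp only [pow_zero, mul_one] at h0
      have hL := hpos (u 0)
      rcases lt_or_gt_of_ne (left_ne_zero_of_mul hL.ne') with hε | hε <;>
        rcases lt_or_gt_of_ne hs with hs | hs <;> nlinarith
    have hk : k = 0 := by
      by_contra hk
      have h1 := hsign 1 (by omega)
      simp only [pow_one] at h1
      have hL := hpos (u 1)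
      have h2 := mul_pos hsε hL
      have h3 : s * ε * (ε * twoSidedLaplace h (u 1)) = ε ^ 2 * (s * twoSidedLaplace h (u 1)) := by
        ring
      rw [h3] at h2
      have := (pos_iff_pos_of_mul_pos h2).1
        (lt_of_le_of_ne (sq_nonneg ε) (left_ne_zero_of_mul h2.ne').symm)
      linarith
    subst hk
    simpa using hsε
  | cons a l ih =>
    intro h hh hnonneg hne k s u hs hu hsign hnz
    rcases k with _ | k
    · simp
    have hmul : ∀ y, (y - a) * h y * (l.map fun a => y - a).prod
        = h y * ((a :: l).map fun a => y - a).prod := fun y => by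
      simp only [List.map_cons, List.prod_cons]; ring
    -- Between consecutive points the values have weakly opposite signs and are not both zero, so
    -- the mean value theorem gives a point where the derivative has a strict sign. This leaves `k`
    -- strict sign changes, starting with the sign of `-s`.
    have hstep : ∀ i, ∃ z, i ≤ k → (u i < z ∧ z < u (i + 1) ∧
        0 < -s * (-1) ^ i * twoSidedLaplace (fun y => (y - a) * h y) z) := by
      intro i
      by_cases hi : i ≤ k
      swap
      · exact ⟨0, fun h => absurd h hi⟩
      have hlt := hu i (by omega)
      obtain ⟨z, hz, hz'⟩ := exists_hasDerivAt_eq_slope _ _ hlt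
        (fun z _ => (hasDerivAt_exp_mul_twoSidedLaplace hh a z).continuousAt.continuousWithinAt)
        (fun z _ => hasDerivAt_exp_mul_twoSidedLaplace hh a z)
      refine ⟨z, fun _ => ⟨hz.1, hz.2, ?_⟩⟩
      have h1 := hsign i (by omega)
      have h2 := hsign (i + 1) (by omega)
      have hc : s * (-1) ^ i ≠ 0 := mul_ne_zero hs (by simp)
      have e2 : s * (-1) ^ (i + 1) = -(s * (-1) ^ i) := by ring
      have e3 : -s * (-1) ^ i = -(s * (-1) ^ i) := by ring
      rw [e2] at h2
      rw [e3]
      set c := s * (-1) ^ i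
      set E₁ := Real.exp (-(a * u i))
      set E₂ := Real.exp (-(a * u (i + 1)))
      have hE₁ : 0 < E₁ := Real.exp_pos _
      have hE₂ : 0 < E₂ := Real.exp_pos _
      have hdiff : 0 < -c * (E₂ * twoSidedLaplace h (u (i + 1)) - E₁ * twoSidedLaplace h (u i)) := by
        have h1' := mul_nonneg hE₁.le h1
        have h2' := mul_nonneg hE₂.le h2
        refine lt_of_le_of_ne (by linarith) fun heq => ?_
        have g1 : E₁ * (c * twoSidedLaplace h (u i)) = 0 := by linarith
        have g2 : E₂ * (-c * twoSidedLaplace h (u (i + 1))) = 0 := by linarith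
        simp only [mul_eq_zero, neg_eq_zero, hE₁.ne', hE₂.ne', hc, false_or] at g1 g2
        exact (hnz i (by omega)).elim (fun h => h g1) (fun h => h g2)
      have hz'' := div_pos hdiff (sub_pos.2 hlt)
      rw [mul_div_assoc, ← hz'] at hz''
      have hE : 0 < Real.exp (-(a * z)) := Real.exp_pos _
      rw [show ∀ L : ℝ, -c * (Real.exp (-(a * z)) * L) = Real.exp (-(a * z)) * (-c * L) from
        fun L => by ring] at hz''
      exact (pos_iff_pos_of_mul_pos hz'').1 hE
    choose v hv using hstep
    obtain ⟨hle, heq⟩ := ih (hh.sub_mul a) (fun y => by rw [hmul]; exact hnonneg y)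
      (by obtain ⟨y, hy⟩ := hne; exact ⟨y, by rw [hmul]; exact hy⟩) k (-s) v (neg_ne_zero.2 hs)
      (fun i hi => (hv i hi.le).2.1.trans (hv (i + 1) hi).1) (fun i hi => (hv i hi).2.2.le)
      (fun i hi => Or.inl (right_ne_zero_of_mul (hv i hi.le).2.2.ne'))
    -- The sign in the equality case carries over because `-s * (-1) ^ k = s * (-1) ^ (k + 1)`.
    refine ⟨by simpa using hle, fun hk => ?_⟩
    have := heq (by simpa using hk)
    rw [pow_succ]
    linarith

end TwoSidedLaplace

/-! ### Sign patterns of a function with finitely many simple sign changes. -/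

section SignChanges

variable {g : ℝ → ℝ} {A : Finset ℝ}

/-- Near a zero with nonzero derivative `D`, the sign of `g y` is that of `D * (y - a)`. -/
theorem exists_pos_of_hasDerivAt_ne_zero {a D : ℝ} (hD : D ≠ 0) (hg : HasDerivAt g D a)
    (ha : g a = 0) : ∃ δ > 0, ∀ y, y ≠ a → |y - a| < δ → 0 < D * g y * (y - a) := by
  have h1 := (hasDerivAt_iff_tendsto_slope.1 hg).const_mul D
  have h2 := h1.eventually_const_lt (mul_self_pos.2 hD)
  rw [eventually_nhdsWithin_iff, Metric.eventually_nhds_iff] at h2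
  obtain ⟨δ, hδ, h⟩ := h2
  refine ⟨δ, hδ, fun y hy hlt => ?_⟩
  have h3 := h (by rwa [Real.dist_eq]) hy
  rw [slope_def_field, ha, sub_zero] at h3
  have hne : y - a ≠ 0 := sub_ne_zero.2 hy
  have h4 := mul_pos h3 (show 0 < (y - a) ^ 2 by positivity)
  have h5 : D * (g y / (y - a)) * (y - a) ^ 2 = D * g y * (y - a) := by
    field_simp
  rwa [h5] at h4

theorem prod_sub_mul_prod_sub_pos {c d : ℝ} (hcd : c ≤ d)
    (hA : ∀ a ∈ A, a < c ∨ d < a) : 0 < (∏ a ∈ A, (c - a)) * ∏ a ∈ A, (d - a) := by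
  rw [← Finset.prod_mul_distrib]
  refine Finset.prod_pos fun a ha => ?_
  rcases hA a ha with h | h
  · exact mul_pos (by linarith) (by linarith)
  · exact mul_pos_of_neg_of_neg (by linarith) (by linarith)

/-- The points of `A` are simple sign changes of `g`, and `g` has no others. -/
structure SimpleSignChanges (g : ℝ → ℝ) (A : Finset ℝ) : Prop where
  zero : ∀ a ∈ A, g a = 0
  simple : ∀ a ∈ A, ∃ D ≠ 0, HasDerivAt g D a
  crossing : ∀ c d, c < d → g c * g d < 0 → ∃ a ∈ A, c < a ∧ a < d

theorem SimpleSignChanges.notMem (hg : SimpleSignChanges g A) {c : ℝ} (hc : g c ≠ 0) : c ∉ A :=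
  fun h => hc (hg.zero c h)

/-- Near `a` the sign of `g` is that of `D * (y - a)`: opposite on the two sides, and never zero off
`a`, which keeps the rest of `A` away. -/
theorem SimpleSignChanges.exists_near (hg : SimpleSignChanges g A) {a : ℝ} (ha : a ∈ A)
    {c d : ℝ} (hca : c < a) (had : a < d) :
    ∃ c' d', c < c' ∧ c' < a ∧ a < d' ∧ d' < d ∧ g c' * g d' < 0 ∧
      ∀ b ∈ A, b ≠ a → b < c' ∨ d' < b := by
  obtain ⟨D, hD, hderiv⟩ := hg.simple a ha
  obtain ⟨δ, hδ, h⟩ := exists_pos_of_hasDerivAt_ne_zero hD hderiv (hg.zero a ha)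
  set η := min δ (min (a - c) (d - a)) / 2 with hη
  have hm : 0 < min δ (min (a - c) (d - a)) :=
    lt_min hδ (lt_min (by linarith) (by linarith))
  have h1 : min δ (min (a - c) (d - a)) ≤ δ := min_le_left _ _
  have h2 : min δ (min (a - c) (d - a)) ≤ a - c := (min_le_right _ _).trans (min_le_left _ _)
  have h3 : min δ (min (a - c) (d - a)) ≤ d - a := (min_le_right _ _).trans (min_le_right _ _)
  have hη0 : 0 < η := by positivity
  have hl := h (a - η) (by linarith) (by rw [abs_lt]; constructor <;> linarith)
  have hr := h (a + η) (by linarith) (by rw [abs_lt]; constructor <;> linarith)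
  refine ⟨a - η, a + η, by linarith, by linarith, by linarith, by linarith, ?_, ?_⟩
  · have h4 := mul_pos hl hr
    have h5 : D * g (a - η) * (a - η - a) * (D * g (a + η) * (a + η - a))
        = (D * η) ^ 2 * -(g (a - η) * g (a + η)) := by ring
    rw [h5] at h4
    have := (pos_iff_pos_of_mul_pos h4).1 (by positivity)
    linarith
  · intro b hb hba
    by_contra! hcon
    have := h b hba (by rw [abs_lt]; constructor <;> linarith)
    simp [hg.zero b hb] at this

/-- Across a point of `A` both `g` and the product flip sign, and across an interval free of `A`
neither does. The induction is on the number of points of `A` in between. Further zeros of `g` are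
harmless, as only `crossing` is used. -/
theorem SimpleSignChanges.mul_prod_pos (hg : SimpleSignChanges g A) :
    ∀ (n : ℕ) (c d : ℝ), (A.filter fun a => c < a ∧ a < d).card = n → c ≤ d → g c ≠ 0 → g d ≠ 0 →
      0 < (g c * ∏ a ∈ A, (c - a)) * (g d * ∏ a ∈ A, (d - a)) := by
  intro n
  induction n using Nat.strong_induction_on with
  | _ n ih =>
  intro c d hn hcd hc hd
  by_cases hex : ∃ a ∈ A, c < a ∧ a < d
  · obtain ⟨a, ha, hca, had⟩ := hex
    obtain ⟨c', d', hcc', hc'a, had', hd'd, hneg, hother⟩ := hg.exists_near ha hca had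
    have hsub : ∀ x y, c ≤ x → y ≤ d → ¬ (x < a ∧ a < y) →
        (A.filter fun a => x < a ∧ a < y).card < n := by
      intro x y hx hy hxy
      rw [← hn]
      refine Finset.card_lt_card (Finset.ssubset_iff_of_subset ?_ |>.2 ⟨a, ?_, ?_⟩)
      · intro b hb
        simp only [Finset.mem_filter] at hb ⊢
        exact ⟨hb.1, by linarith, by linarith⟩
      · simp [ha, hca, had]
      · simp only [Finset.mem_filter, not_and]
        exact fun _ h1 h2 => hxy ⟨h1, h2⟩
    have h1 := ih _ (hsub c c' le_rfl (by linarith) (by intro h; linarith)) c c' rfl hcc'.le hc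
      (left_ne_zero_of_mul hneg.ne)
    have h2 := ih _ (hsub d' d (by linarith) le_rfl (by intro h; linarith)) d' d rfl hd'd.le
      (right_ne_zero_of_mul hneg.ne) hd
    have h3 : 0 < (g c' * ∏ a ∈ A, (c' - a)) * (g d' * ∏ a ∈ A, (d' - a)) := by
      have hP := prod_sub_mul_prod_sub_pos (A := A.erase a) (c := c') (d := d') (by linarith)
        fun b hb => hother b (Finset.mem_of_mem_erase hb) (Finset.ne_of_mem_erase hb)
      rw [← Finset.mul_prod_erase A _ ha, ← Finset.mul_prod_erase A (fun b => d' - b) ha]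
      have h4 : 0 < (a - c') * (d' - a) := mul_pos (by linarith) (by linarith)
      have := mul_pos (mul_pos (neg_pos.2 hneg) h4) hP
      linarith
    have h4 := mul_pos (mul_pos h1 h2) h3
    set p := g c * ∏ a ∈ A, (c - a)
    set q := g d * ∏ a ∈ A, (d - a)
    set p' := g c' * ∏ a ∈ A, (c' - a)
    set q' := g d' * ∏ a ∈ A, (d' - a)
    have h5 : p * p' * (q' * q) * (p' * q') = (p' * q') ^ 2 * (p * q) := by ring
    rw [h5] at h4
    exact (pos_iff_pos_of_mul_pos h4).1 (by positivity)
  · push Not at hex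
    have hgg : 0 < g c * g d := by
      refine lt_of_le_of_ne ?_ (mul_ne_zero hc hd).symm
      by_contra! hlt
      rcases hcd.eq_or_lt with rfl | hcd
      · nlinarith
      · obtain ⟨a, ha, h1, h2⟩ := hg.crossing c d hcd hlt
        exact absurd h2 (not_lt.2 (hex a ha h1))
    have hP := prod_sub_mul_prod_sub_pos (A := A) hcd fun a ha => by
      have hca : a ≠ c := fun h => hg.notMem hc (h ▸ ha)
      have hda : a ≠ d := fun h => hg.notMem hd (h ▸ ha)
      rcases lt_or_gt_of_ne hca with h | h
      · exact Or.inl h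
      · exact Or.inr (lt_of_le_of_ne (hex a ha h) hda.symm)
    have := mul_pos hgg hP
    linarith

/-- `g y * ∏ (y - a)` has a constant sign. -/
theorem SimpleSignChanges.exists_sign (hg : SimpleSignChanges g A) (hne : ∃ y, g y ≠ 0) :
    ∃ ε : ℝ, (∀ y, 0 ≤ ε * (g y * ∏ a ∈ A, (y - a))) ∧
      ∀ y, g y ≠ 0 → 0 < ε * (g y * ∏ a ∈ A, (y - a)) := by
  obtain ⟨c, hc⟩ := hne
  have hpos : ∀ y, g y ≠ 0 → 0 < (g c * ∏ a ∈ A, (c - a)) * (g y * ∏ a ∈ A, (y - a)) := by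
    intro y hy
    rcases le_total c y with h | h
    · exact hg.mul_prod_pos _ c y rfl h hc hy
    · rw [mul_comm]
      exact hg.mul_prod_pos _ y c rfl h hy hc
  refine ⟨_, fun y => ?_, hpos⟩
  by_cases hy : g y = 0
  · simp [hy]
  · exact (hpos y hy).le

/-- Each point to the right of `y` contributes one negative factor; this reads the sign of `g y` off
a count. -/
theorem neg_one_pow_card_mul_prod_sub_pos {y : ℝ} (hy : y ∉ A) :
    0 < (-1) ^ (A.filter fun a => y < a).card * ∏ a ∈ A, (y - a) := by
  rw [← Finset.prod_const, Finset.prod_filter, ← Finset.prod_mul_distrib]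
  refine Finset.prod_pos fun a ha => ?_
  have hya : y ≠ a := fun h => hy (h ▸ ha)
  split_ifs with h
  · linarith
  · have := lt_of_le_of_ne (not_lt.1 h) hya.symm
    linarith

/-- Each step jumps just past the leftmost remaining point of `A`. The recorded count drops by one,
so its parity, which fixes the sign of `g`, alternates. -/
theorem SimpleSignChanges.exists_chain_from (hg : SimpleSignChanges g A) :
    ∀ (n : ℕ) (c : ℝ), g c ≠ 0 → (A.filter fun a => c < a).card = n →
      ∃ z : ℕ → ℝ, (∀ i < n, z i < z (i + 1)) ∧ z 0 = c ∧
        ∀ i ≤ n, g (z i) ≠ 0 ∧ (A.filter fun a => z i < a).card = n - i := by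
  intro n
  induction n with
  | zero =>
    intro c hc hn
    refine ⟨fun _ => c, by simp, rfl, fun i hi => ?_⟩
    have : i = 0 := by omega
    subst this
    exact ⟨hc, hn⟩
  | succ n ih =>
    intro c hc hn
    have hne : (A.filter fun a => c < a).Nonempty := by
      rw [← Finset.card_pos]; omega
    set a := (A.filter fun a => c < a).min' hne with ha_def
    have ha := Finset.min'_mem _ hne
    rw [← ha_def, Finset.mem_filter] at ha
    obtain ⟨c', d', hcc', hc'a, had', -, hneg, hother⟩ :=
      hg.exists_near ha.1 ha.2 (lt_add_one a)
    have hfilter : (A.filter fun b => d' < b) = (A.filter fun b => c < b).erase a := by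
      ext b
      simp only [Finset.mem_filter, Finset.mem_erase]
      refine ⟨fun h => ⟨by linarith [h.2], h.1, by linarith [h.2, ha.2]⟩, fun h => ⟨h.2.1, ?_⟩⟩
      have hab : a ≤ b := Finset.min'_le _ _ (Finset.mem_filter.2 h.2)
      exact (hother b h.2.1 h.1).resolve_left (by linarith)
    obtain ⟨z, hz, hz0, hz'⟩ := ih d' (right_ne_zero_of_mul hneg.ne) (by
      rw [hfilter, Finset.card_erase_of_mem (Finset.mem_filter.2 ha), hn]; rfl)
    refine ⟨fun i => Nat.casesOn i c z, ?_, rfl, ?_⟩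
    · rintro (_ | i) hi
      · change c < z 0
        rw [hz0]; linarith [ha.2]
      · exact hz i (by omega)
    · rintro (_ | i) hi
      · exact ⟨hc, hn⟩
      · have := hz' i (by omega)
        exact ⟨this.1, by rw [this.2]; omega⟩

/-- `g` takes alternating strict signs around the points of `A`. -/
theorem SimpleSignChanges.exists_alternating (hg : SimpleSignChanges g A) (hne : ∃ y, g y ≠ 0)
    {ε : ℝ} (hε : ∀ y, g y ≠ 0 → 0 < ε * (g y * ∏ a ∈ A, (y - a))) :
    ∃ z : ℕ → ℝ, (∀ i < A.card, z i < z (i + 1)) ∧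
      ∀ i ≤ A.card, 0 < ε * (-1) ^ (A.card - i) * g (z i) := by
  -- The chain starts to the left of all of `A`: just before its minimum, or anywhere with `g`
  -- nonzero if `A` is empty.
  obtain ⟨c, hc, hcA⟩ : ∃ c, g c ≠ 0 ∧ ∀ a ∈ A, c < a := by
    rcases A.eq_empty_or_nonempty with rfl | hA
    · obtain ⟨y, hy⟩ := hne
      exact ⟨y, hy, by simp⟩
    · obtain ⟨c, d, _, hca, _, _, hneg, _⟩ :=
        hg.exists_near (A.min'_mem hA) (sub_one_lt _) (lt_add_one _)
      exact ⟨c, left_ne_zero_of_mul hneg.ne, fun a ha => hca.trans_le (A.min'_le a ha)⟩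
  obtain ⟨z, hz, -, hz'⟩ := hg.exists_chain_from A.card c hc (by rw [Finset.filter_true_of_mem hcA])
  refine ⟨z, hz, fun i hi => ?_⟩
  obtain ⟨h1, h2⟩ := hz' i hi
  have h3 := neg_one_pow_card_mul_prod_sub_pos (hg.notMem h1)
  rw [h2] at h3
  have h4 := mul_pos (hε _ h1) h3
  have h5 : ε * (g (z i) * ∏ a ∈ A, (z i - a)) * ((-1) ^ (A.card - i) * ∏ a ∈ A, (z i - a))
      = (∏ a ∈ A, (z i - a)) ^ 2 * (ε * (-1) ^ (A.card - i) * g (z i)) := by ring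
  rw [h5] at h4
  exact (pos_iff_pos_of_mul_pos h4).1 (lt_of_le_of_ne (sq_nonneg _) (left_ne_zero_of_mul h4.ne').symm)

end SignChanges

/-! ### Counting connected components of subsets of the line by alternating chains. -/

section Components

/-- Connected subsets of the line are order-convex, so only a gap can separate two points. -/
theorem connectedComponents_mk_ne_iff {S : Set ℝ} {x y : S} (hxy : (x : ℝ) < y) :
    (x : ConnectedComponents S) ≠ y ↔ ∃ z, (x : ℝ) < z ∧ z < y ∧ z ∉ S := by
  constructor
  · intro h
    by_contra! hcon
    have hsub : Set.Icc (x : ℝ) y ⊆ S := by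
      intro z hz
      rcases hz.1.eq_or_lt with rfl | h1
      · exact x.2
      rcases hz.2.eq_or_lt with rfl | h2
      · exact y.2
      exact hcon z h1 h2
    have hpre : IsPreconnected ((↑) ⁻¹' Set.Icc (x : ℝ) y : Set S) := by
      rw [← Topology.IsInducing.subtypeVal.isPreconnected_image, Subtype.image_preimage_coe,
        Set.inter_eq_self_of_subset_right hsub]
      exact isPreconnected_Icc
    refine h (ConnectedComponents.coe_eq_coe'.2
      (hpre.subset_connectedComponent (x := y) ?_ ?_))
    · exact ⟨hxy.le, le_rfl⟩
    · exact ⟨le_rfl, hxy.le⟩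
  · rintro ⟨z, hxz, hzy, hz⟩ h
    rw [ConnectedComponents.coe_eq_coe'] at h
    have hpre : IsPreconnected ((↑) '' connectedComponent y : Set ℝ) :=
      isPreconnected_connectedComponent.image _ continuous_subtype_val.continuousOn
    obtain ⟨w, -, hw⟩ := hpre.ordConnected.out ⟨x, h, rfl⟩ ⟨y, mem_connectedComponent, rfl⟩
      ⟨hxz.le, hzy.le⟩
    exact hz (hw ▸ w.2)

/-- `u 0 < ⋯ < u (2n)` lie alternately inside and outside `S`, starting inside. -/
def AlternatesIn (S : Set ℝ) (n : ℕ) (u : ℕ → ℝ) : Prop :=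
  (∀ i < 2 * n, u i < u (i + 1)) ∧ (∀ i ≤ n, u (2 * i) ∈ S) ∧ ∀ i < n, u (2 * i + 1) ∉ S

theorem AlternatesIn.le_intervalCount {S : Set ℝ} {n : ℕ} {u : ℕ → ℝ} (hu : AlternatesIn S n u) :
    ((n + 1 : ℕ) : ℕ∞) ≤ intervalCount S := by
  obtain ⟨hmono, hin, hout⟩ := hu
  have hmono' : ∀ i j, i ≤ j → j ≤ 2 * n → u i ≤ u j := by
    intro i j hij
    induction j, hij using Nat.le_induction with
    | base => exact fun _ => le_rfl
    | succ j _ ih => exact fun h => (ih (by omega)).trans (hmono j (by omega)).le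
  let φ : Fin (n + 1) → ConnectedComponents S := fun i =>
    ((⟨u (2 * i), hin i (by omega)⟩ : S) : ConnectedComponents S)
  have hφ : ∀ i j, i < j → φ i ≠ φ j := by
    intro i j hij
    have h1 : u (2 * i) < u (2 * i + 1) := hmono _ (by omega)
    have h2 : u (2 * i + 1) < u (2 * i + 2) := hmono _ (by omega)
    have h3 : u (2 * i + 2) ≤ u (2 * j) := hmono' _ _ (by omega) (by omega)
    have hlt : u (2 * i) < u (2 * j) := by linarith
    exact (connectedComponents_mk_ne_iff (S := S) (x := ⟨u (2 * i), hin i (by omega)⟩)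
      (y := ⟨u (2 * j), hin j (by omega)⟩) hlt).2 ⟨_, h1, h2.trans_le h3, hout i (by omega)⟩
  have hinj : Function.Injective φ := by
    intro i j hij
    rcases lt_trichotomy i j with h | h | h
    · exact absurd hij (hφ i j h)
    · exact h
    · exact absurd hij.symm (hφ j i h)
  have := ENat.card_le_card_of_injective hinj
  simpa [intervalCount] using this

/-- Representatives of `n + 1` components, sorted, have a gap of `S` between neighbours. The count
may be `⊤`, hence the passage to a finite set of components. -/
theorem exists_alternatesIn {S : Set ℝ} {n : ℕ} (hn : ((n + 1 : ℕ) : ℕ∞) ≤ intervalCount S) :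
    ∃ u, AlternatesIn S n u := by
  rw [intervalCount, ← Set.encard_univ] at hn
  obtain ⟨T, -, hT⟩ := Set.exists_subset_encard_eq hn
  obtain ⟨r, hr⟩ := (ConnectedComponents.surjective_coe (α := S)).hasRightInverse
  have hTfin : T.Finite := Set.finite_of_encard_eq_coe hT
  have hcard : (hTfin.toFinset.image fun c => (r c : ℝ)).card = n + 1 := by
    rw [Finset.card_image_of_injective _ (show Function.Injective fun c => (r c : ℝ) from
      Subtype.val_injective.comp hr.injective), ← Set.ncard_eq_toFinset_card T hTfin, Set.ncard, hT]
    rfl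
  have hgap : ∀ x ∈ hTfin.toFinset.image (fun c => (r c : ℝ)),
      ∀ y ∈ hTfin.toFinset.image (fun c => (r c : ℝ)), x < y → ∃ z, x < z ∧ z < y ∧ z ∉ S := by
    intro x hx y hy hxy
    obtain ⟨c, -, rfl⟩ := Finset.mem_image.1 hx
    obtain ⟨d, -, rfl⟩ := Finset.mem_image.1 hy
    refine (connectedComponents_mk_ne_iff hxy).1 ?_
    rw [hr c, hr d]
    rintro rfl
    exact lt_irrefl _ hxy
  have hS : ∀ x ∈ hTfin.toFinset.image (fun c => (r c : ℝ)), x ∈ S := by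
    intro x hx
    obtain ⟨c, -, rfl⟩ := Finset.mem_image.1 hx
    exact (r c).2
  generalize hTfin.toFinset.image (fun c => (r c : ℝ)) = U at hcard hgap hS
  let e := U.orderEmbOfFin hcard
  let x : ℕ → ℝ := fun i => if h : i < n + 1 then e ⟨i, h⟩ else 0
  have hxU : ∀ i ≤ n, x i ∈ U := fun i hi => by
    simp only [x, dif_pos (show i < n + 1 by omega)]
    exact U.orderEmbOfFin_mem hcard _
  have hxlt : ∀ i < n, x i < x (i + 1) := fun i hi => by
    simp only [x, dif_pos (show i < n + 1 by omega), dif_pos (show i + 1 < n + 1 by omega)]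
    exact e.lt_iff_lt.2 (by simp [Fin.lt_def])
  have hy : ∀ i, ∃ z, i < n → (x i < z ∧ z < x (i + 1) ∧ z ∉ S) := fun i => by
    by_cases hi : i < n
    · obtain ⟨z, hz⟩ := hgap _ (hxU i hi.le) _ (hxU (i + 1) hi) (hxlt i hi)
      exact ⟨z, fun _ => hz⟩
    · exact ⟨0, fun h => absurd h hi⟩
  choose y hy using hy
  have heven : ∀ i, (if Even (2 * i) then x (2 * i / 2) else y (2 * i / 2)) = x i := fun i => by
    simp
  have hodd : ∀ i, (if Even (2 * i + 1) then x ((2 * i + 1) / 2) else y ((2 * i + 1) / 2)) = y i :=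
    fun i => by
      rw [if_neg (by simp), show (2 * i + 1) / 2 = i by omega]
  -- Representatives occupy the even indices, gap points the odd ones.
  refine ⟨fun j => if Even j then x (j / 2) else y (j / 2), fun i hi => ?_, fun i hi => ?_,
    fun i hi => ?_⟩
  · rcases Nat.even_or_odd' i with ⟨k, rfl | rfl⟩
    · simp only [heven, hodd]
      exact (hy k (by omega)).1
    · simp only [hodd, show 2 * k + 1 + 1 = 2 * (k + 1) by ring, heven]
      exact (hy k (by omega)).2.1
  · simp only [heven]
    exact hS _ (hxU i hi)
  · simp only [hodd]
    exact (hy i hi).2.2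

/-- An inequality in `ℕ∞` is tested on natural numbers, so infinite counts need no separate case. -/
theorem intervalCount_le_of_alternatesIn {S T : Set ℝ}
    (h : ∀ n u, AlternatesIn S n u → ∃ v, AlternatesIn T n v) :
    intervalCount S ≤ intervalCount T := by
  refine ENat.forall_natCast_le_iff_le.1 fun n hn => ?_
  rcases n with _ | n
  · simp
  · obtain ⟨u, hu⟩ := exists_alternatesIn hn
    obtain ⟨v, hv⟩ := h n u hu
    exact hv.le_intervalCount

theorem intervalCount_le_encard (S : Set ℝ) : intervalCount S ≤ S.encard := by
  obtain ⟨r, hr⟩ := (ConnectedComponents.surjective_coe (α := S)).hasRightInverse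
  exact ENat.card_le_card_of_injective hr.injective

/-- A finite subset of the line is discrete, so its components are single points. -/
theorem encard_le_intervalCount {S : Set ℝ} (hS : S.Finite) : S.encard ≤ intervalCount S := by
  have : Finite S := hS
  refine ENat.card_le_card_of_injective (f := ((↑) : S → ConnectedComponents S)) fun x y hxy => ?_
  rw [ConnectedComponents.coe_eq_coe'] at hxy
  simpa using hxy

end Components

/-! ### The smoothing kernel and its reduction to a Laplace transform. -/

section GaussianKernel

variable {σ : ℝ}

/-- The Fourier integral of a Gaussian with rate `2 * π ^ 2 * σ ^ 2` at frequency `2 * π * s`; the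
result is the centred normal density of variance `σ ^ 2`. -/
theorem smoothingKernel_eq (hσ : 0 < σ) (s : ℝ) :
    smoothingKernel σ s
      = (((√(2 * Real.pi * σ ^ 2))⁻¹ * Real.exp (-(1 / (2 * σ ^ 2)) * s ^ 2) : ℝ) : ℂ) := by
  have hb : 0 < 2 * Real.pi ^ 2 * σ ^ 2 := by positivity
  have h := fourierIntegral_gaussian (b := ((2 * Real.pi ^ 2 * σ ^ 2 : ℝ) : ℂ))
    (by rwa [Complex.ofReal_re]) (2 * Real.pi * s)
  have hconst : ((Real.pi : ℂ) / ((2 * Real.pi ^ 2 * σ ^ 2 : ℝ) : ℂ)) ^ (1 / 2 : ℂ)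
      = (((√(2 * Real.pi * σ ^ 2))⁻¹ : ℝ) : ℂ) := by
    rw [← Real.sqrt_inv, Real.sqrt_eq_rpow, Complex.ofReal_cpow (by positivity)]
    have : Real.pi / (2 * Real.pi ^ 2 * σ ^ 2) = (2 * Real.pi * σ ^ 2)⁻¹ := by
      field_simp
    rw [← this]
    push_cast
    rfl
  have hexp : -(2 * Real.pi * s : ℂ) ^ 2 / (4 * ((2 * Real.pi ^ 2 * σ ^ 2 : ℝ) : ℂ))
      = ((-(1 / (2 * σ ^ 2)) * s ^ 2 : ℝ) : ℂ) := by
    have : -(1 / (2 * σ ^ 2)) * s ^ 2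
        = -(2 * Real.pi * s) ^ 2 / (4 * (2 * Real.pi ^ 2 * σ ^ 2)) := by
      field_simp
      ring
    rw [this]
    push_cast
    rfl
  rw [hconst, hexp, ← Complex.ofReal_exp, ← Complex.ofReal_mul] at h
  rw [← h, smoothingKernel]
  congr 1
  funext w
  rw [mul_comm, gaussianLowPass, Complex.ofReal_exp]
  congr 2
  · ring
  · push_cast
    ring

theorem integrable_gaussian_sub {b : ℝ} (hb : 0 < b) (x : ℝ) :
    Integrable fun y : ℝ => Real.exp (-b * (x - y) ^ 2) :=
  (integrable_exp_neg_mul_sq hb).comp_sub_left x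

theorem integral_gaussianKernel (hσ : 0 < σ) (x : ℝ) :
    ∫ y : ℝ, (√(2 * Real.pi * σ ^ 2))⁻¹ * Real.exp (-(1 / (2 * σ ^ 2)) * (x - y) ^ 2) = 1 := by
  rw [integral_const_mul,
    integral_sub_left_eq_self (fun y : ℝ => Real.exp (-(1 / (2 * σ ^ 2)) * y ^ 2)) volume x,
    integral_gaussian]
  have : Real.pi / (1 / (2 * σ ^ 2)) = 2 * Real.pi * σ ^ 2 := by
    field_simp
  rw [this]
  exact inv_mul_cancel₀ (by positivity)

theorem fourierSmoothing_eq_integral (hσ : 0 < σ) (f : ℝ → ℝ) (x : ℝ) :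
    fourierSmoothing σ f x = ∫ y : ℝ, f y *
      ((√(2 * Real.pi * σ ^ 2))⁻¹ * Real.exp (-(1 / (2 * σ ^ 2)) * (x - y) ^ 2)) := by
  apply Complex.ofReal_injective
  rw [fourierSmoothing_coe, ← integral_complex_ofReal]
  congr 1
  funext y
  rw [smoothingKernel_eq hσ, Complex.ofReal_mul (f y)]

/-- The cross term of the square becomes the Laplace kernel at `x / σ ^ 2`. -/
theorem gaussian_sub_eq (hσ : 0 < σ) (x y : ℝ) :
    Real.exp (-(1 / (2 * σ ^ 2)) * (x - y) ^ 2)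
      = Real.exp (-(1 / (2 * σ ^ 2)) * x ^ 2) *
        (Real.exp (-(1 / (2 * σ ^ 2)) * y ^ 2) * Real.exp (x / σ ^ 2 * y)) := by
  rw [← Real.exp_add, ← Real.exp_add]
  congr 1
  field_simp
  ring

theorem integrable_bounded_mul_gaussian_sub (hσ : 0 < σ) {g : ℝ → ℝ} (hg : Continuous g)
    (hbdd : ∃ C, ∀ y, |g y| ≤ C) (x : ℝ) :
    Integrable fun y => g y * Real.exp (-(1 / (2 * σ ^ 2)) * (x - y) ^ 2) := by
  obtain ⟨C, hC⟩ := hbdd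
  exact (integrable_gaussian_sub (by positivity) x).bdd_mul hg.aestronglyMeasurable
    (Filter.Eventually.of_forall hC)

theorem laplaceAdmissible_mul_gaussian (hσ : 0 < σ) {g : ℝ → ℝ} (hg : Continuous g)
    (hbdd : ∃ C, ∀ y, |g y| ≤ C) :
    LaplaceAdmissible fun y => g y * Real.exp (-(1 / (2 * σ ^ 2)) * y ^ 2) := by
  refine ⟨by fun_prop, fun x => ?_⟩
  -- The Laplace integrand at `x` is a constant multiple of the convolution integrand at `x * σ ^
  -- 2`.
  refine ((integrable_bounded_mul_gaussian_sub hσ hg hbdd (x * σ ^ 2)).const_mul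
    (Real.exp (-(1 / (2 * σ ^ 2)) * (x * σ ^ 2) ^ 2))⁻¹).congr
    (Filter.Eventually.of_forall fun y => ?_)
  simp only
  rw [gaussian_sub_eq hσ, mul_div_assoc, div_self (by positivity), mul_one]
  have := Real.exp_ne_zero (-(1 / (2 * σ ^ 2)) * (x * σ ^ 2) ^ 2)
  generalize Real.exp (-(1 / (2 * σ ^ 2)) * (x * σ ^ 2) ^ 2) = E at this ⊢
  field_simp

/-- Up to a positive factor, `f̃ - t` is a Laplace transform of `f - t` times a Gaussian. -/
theorem exists_fourierSmoothing_sub_eq (hσ : 0 < σ) {f : ℝ → ℝ} (hf : Continuous f)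
    (hbdd : ∃ C, ∀ y, |f y| ≤ C) (t x : ℝ) :
    ∃ E > 0, fourierSmoothing σ f x - t = E *
      twoSidedLaplace (fun y => (f y - t) * Real.exp (-(1 / (2 * σ ^ 2)) * y ^ 2)) (x / σ ^ 2) := by
  refine ⟨(√(2 * Real.pi * σ ^ 2))⁻¹ * Real.exp (-(1 / (2 * σ ^ 2)) * x ^ 2), by positivity, ?_⟩
  have ht : t = ∫ y : ℝ, t * ((√(2 * Real.pi * σ ^ 2))⁻¹ *
      Real.exp (-(1 / (2 * σ ^ 2)) * (x - y) ^ 2)) := by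
    rw [integral_const_mul, integral_gaussianKernel hσ, mul_one]
  have h1 : Integrable fun y : ℝ => f y * ((√(2 * Real.pi * σ ^ 2))⁻¹ *
      Real.exp (-(1 / (2 * σ ^ 2)) * (x - y) ^ 2)) :=
    ((integrable_bounded_mul_gaussian_sub hσ hf hbdd x).const_mul (√(2 * Real.pi * σ ^ 2))⁻¹).congr
      (Filter.Eventually.of_forall fun y => by simp only; ring)
  have h2 : Integrable fun y : ℝ => t * ((√(2 * Real.pi * σ ^ 2))⁻¹ *
      Real.exp (-(1 / (2 * σ ^ 2)) * (x - y) ^ 2)) :=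
    ((integrable_gaussian_sub (by positivity) x).const_mul _).const_mul t
  rw [fourierSmoothing_eq_integral hσ]
  -- The kernel has mass one, so `t` is its own Gaussian average and can be moved under the
  -- integral.
  conv_lhs => rw [ht]
  rw [← integral_sub h1 h2, twoSidedLaplace, ← integral_const_mul]
  congr 1
  funext y
  rw [gaussian_sub_eq hσ]
  ring

end GaussianKernel

/-! ### From the crossings of `f` to the two conclusions. -/

theorem simpleSignChanges_of_crossingSet {f : ℝ → ℝ} (hf : Differentiable ℝ f) {t : ℝ}
    (hcross : ∀ a b : ℝ, a < b → (f a - t) * (f b - t) < 0 →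
      ∃ x ∈ Set.Ioo a b, x ∈ crossingSet f t)
    (hfin : (crossingSet f t).Finite) :
    SimpleSignChanges (fun y => f y - t) hfin.toFinset where
  zero a ha := sub_eq_zero.2 ((hfin.mem_toFinset.1 ha).1)
  simple a ha := ⟨deriv f a, (hfin.mem_toFinset.1 ha).2, (hf a).hasDerivAt.sub_const t⟩
  crossing c d hcd h := by
    obtain ⟨x, hx, hxA⟩ := hcross c d hcd h
    exact ⟨x, hfin.mem_toFinset.2 hxA, hx.1, hx.2⟩

/-- If `g` changes sign `m ≥ 2n` times, ending with the sign of `ε`, and `ε > 0` when `m = 2n`, then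
`g` alternates `2n` times starting with a nonnegative value. -/
theorem exists_alternatesIn_nonneg {g : ℝ → ℝ} {m n : ℕ} {ε : ℝ} {z : ℕ → ℝ}
    (hz : ∀ i < m, z i < z (i + 1)) (hsign : ∀ i ≤ m, 0 < ε * (-1) ^ (m - i) * g (z i))
    (hle : 2 * n ≤ m) (heq : 2 * n = m → 0 < ε) :
    ∃ v, AlternatesIn {y | 0 ≤ g y} n v := by
  have hsuff : ∀ v : ℕ → ℝ, (∀ i < 2 * n, v i < v (i + 1)) →
      (∀ i ≤ 2 * n, 0 < (-1) ^ i * g (v i)) → AlternatesIn {y | 0 ≤ g y} n v := by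
    refine fun v hv h => ⟨hv, fun i hi => ?_, fun i hi => ?_⟩
    · have := h (2 * i) (by omega)
      rw [pow_mul, neg_one_sq, one_pow, one_mul] at this
      exact this.le
    · have := h (2 * i + 1) (by omega)
      rw [pow_succ, pow_mul, neg_one_sq, one_pow] at this
      simp only [Set.mem_ofPred_eq, not_le]
      linarith
  have hpow : ∀ i ≤ m, (-1 : ℝ) ^ (m - i) = (-1) ^ m * (-1) ^ i := fun i hi => by
    obtain ⟨j, rfl⟩ := Nat.exists_eq_add_of_le hi
    rw [Nat.add_sub_cancel_left, pow_add, mul_right_comm, ← mul_pow]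
    norm_num
  have hsign' : ∀ i ≤ m, 0 < ε * (-1) ^ m * ((-1) ^ i * g (z i)) := fun i hi => by
    have := hsign i hi
    rw [hpow i hi] at this
    linarith
  rcases lt_or_ge 0 (ε * (-1) ^ m) with hpos | hneg
  · exact ⟨z, hsuff z (fun i hi => hz i (by omega)) fun i hi =>
      (pos_iff_pos_of_mul_pos (hsign' i (by omega))).1 hpos⟩
  -- Here `g (z 0)` is negative, so the chain starts at `z 1`. This costs one sign change, which is
  -- available: `2 * n = m` would give `ε > 0` and a positive start.
  · have hlt : 2 * n < m := lt_of_le_of_ne hle fun h => by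
      have h1 := heq h
      rw [← h, pow_mul, neg_one_sq, one_pow, mul_one] at hneg
      linarith
    refine ⟨fun i => z (i + 1), hsuff _ (fun i hi => hz _ (by omega)) fun i hi => ?_⟩
    have h1 := hsign' (i + 1) (by omega)
    rw [pow_succ, show ε * (-1) ^ m * ((-1) ^ i * -1 * g (z (i + 1)))
      = -(ε * (-1) ^ m) * ((-1) ^ i * g (z (i + 1))) by ring] at h1
    exact (pos_iff_pos_of_mul_pos h1).1
      (lt_of_le_of_ne (by linarith) (left_ne_zero_of_mul h1.ne').symm)

theorem theorem2
    (σ : ℝ) (hσ : 0 < σ)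
    (f : ℝ → ℝ) (hf_bdd : ∃ C : ℝ, ∀ x, |f x| ≤ C) (hf_meas : Measurable f)
    (hf_diff : Differentiable ℝ f)
    (t : ℝ) (ht : ∃ x, f x ≠ t)
    (hcross : ∀ a b : ℝ, a < b → (f a - t) * (f b - t) < 0 →
      ∃ x ∈ Set.Ioo a b, x ∈ crossingSet f t)
    (hfin : (crossingSet f t).Finite) :
    ((levelSet (fourierSmoothing σ f) t).Finite ∧
      (levelSet (fourierSmoothing σ f) t).ncard ≤ (crossingSet f t).ncard) ∧
    intervalCount (levelSet (fourierSmoothing σ f) t) ≤ intervalCount (crossingSet f t) ∧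
    intervalCount (predictionSet (fourierSmoothing σ f) t) ≤
      intervalCount (predictionSet f t) := by
  have hg := simpleSignChanges_of_crossingSet hf_diff hcross hfin
  have hcard : (crossingSet f t).ncard = hfin.toFinset.card := Set.ncard_eq_toFinset_card _ hfin
  generalize hfin.toFinset = A at hg hcard
  have hne : ∃ y, f y - t ≠ 0 := ht.imp fun y hy => sub_ne_zero.2 hy
  obtain ⟨ε, hε, hε'⟩ := hg.exists_sign hne
  obtain ⟨z, hz, hzsign⟩ := hg.exists_alternating hne hε'
  have hadm : LaplaceAdmissible fun y => (f y - t) * Real.exp (-(1 / (2 * σ ^ 2)) * y ^ 2) := by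
    refine laplaceAdmissible_mul_gaussian hσ (hf_diff.continuous.sub continuous_const) ?_
    obtain ⟨C, hC⟩ := hf_bdd
    exact ⟨C + |t|, fun y => (abs_sub _ _).trans (by linarith [hC y])⟩
  -- The Gaussian factor is positive, so the sign pattern of `f - t` is inherited.
  have hrw : ∀ y, ε * ((f y - t) * Real.exp (-(1 / (2 * σ ^ 2)) * y ^ 2) *
      (A.toList.map fun a => y - a).prod)
      = Real.exp (-(1 / (2 * σ ^ 2)) * y ^ 2) * (ε * ((f y - t) * ∏ a ∈ A, (y - a))) := fun y => by
    rw [Finset.prod_map_toList]; ring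
  have hnonneg : ∀ y, 0 ≤ ε * ((f y - t) * Real.exp (-(1 / (2 * σ ^ 2)) * y ^ 2) *
      (A.toList.map fun a => y - a).prod) := fun y => by
    rw [hrw]
    exact mul_nonneg (Real.exp_pos _).le (hε y)
  have hnz : ∃ y, ε * ((f y - t) * Real.exp (-(1 / (2 * σ ^ 2)) * y ^ 2) *
      (A.toList.map fun a => y - a).prod) ≠ 0 := by
    obtain ⟨y, hy⟩ := hne
    exact ⟨y, by rw [hrw]; exact mul_ne_zero (Real.exp_ne_zero _) (hε' y hy).ne'⟩
  have hF := exists_fourierSmoothing_sub_eq hσ hf_diff.continuous hf_bdd t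
  have hσ2 : 0 < σ ^ 2 := by positivity
  have hzeros : ∀ s : Finset ℝ, (↑s ⊆ levelSet (fourierSmoothing σ f) t) → s.card ≤ A.card := by
    intro s hs
    have h := card_zeros_twoSidedLaplace_le A.toList hadm hnonneg hnz
      (s.image fun x => x / σ ^ 2) fun x hx => by
        obtain ⟨y, hy, rfl⟩ := Finset.mem_image.1 hx
        obtain ⟨E, hE, h⟩ := hF y
        rw [show fourierSmoothing σ f y = t from hs hy, sub_self] at h
        exact (mul_eq_zero.1 h.symm).resolve_left hE.ne'
    rwa [Finset.card_image_of_injective _ (fun x y hxy => (div_left_inj' hσ2.ne').1 hxy),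
      Finset.length_toList] at h
  have hBfin : (levelSet (fourierSmoothing σ f) t).Finite := by
    by_contra hinf
    obtain ⟨s, hs, hcard⟩ := Set.Infinite.exists_subset_card_eq hinf (A.card + 1)
    have := hzeros s hs
    omega
  have hBcard : (levelSet (fourierSmoothing σ f) t).ncard ≤ (crossingSet f t).ncard := by
    rw [hcard, Set.ncard_eq_toFinset_card _ hBfin]
    exact hzeros _ (by simp)
  refine ⟨⟨hBfin, hBcard⟩, ?_, ?_⟩
  · calc intervalCount (levelSet (fourierSmoothing σ f) t)
        ≤ (levelSet (fourierSmoothing σ f) t).encard := intervalCount_le_encard _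
      _ ≤ (crossingSet f t).encard := by
        rw [← hBfin.cast_ncard_eq, ← hfin.cast_ncard_eq]
        exact_mod_cast hBcard
      _ ≤ intervalCount (crossingSet f t) := encard_le_intervalCount hfin
  · refine intervalCount_le_of_alternatesIn fun n u hu => ?_
    have hin : ∀ i ≤ n, 0 ≤ twoSidedLaplace
        (fun y => (f y - t) * Real.exp (-(1 / (2 * σ ^ 2)) * y ^ 2)) (u (2 * i) / σ ^ 2) :=
      fun i hi => by
        obtain ⟨E, hE, h⟩ := hF (u (2 * i))
        have h1 : 0 ≤ fourierSmoothing σ f (u (2 * i)) - t := sub_nonneg.2 (hu.2.1 i hi)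
        rw [h] at h1
        exact nonneg_of_mul_nonneg_right h1 hE
    have hout : ∀ i < n, twoSidedLaplace
        (fun y => (f y - t) * Real.exp (-(1 / (2 * σ ^ 2)) * y ^ 2)) (u (2 * i + 1) / σ ^ 2) < 0 :=
      fun i hi => by
        obtain ⟨E, hE, h⟩ := hF (u (2 * i + 1))
        have h1 : fourierSmoothing σ f (u (2 * i + 1)) - t < 0 :=
          sub_neg.2 (not_le.1 (hu.2.2 i hi))
        rw [h] at h1
        exact neg_of_mul_neg_right h1 hE.le
    -- Points inside the prediction set give only weak inequalities, but each consecutive pair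
    -- contains an odd index, where the inequality is strict. Since the chain starts inside, `s =
    -- 1`, and `2 * n = A.card` forces `ε > 0`.
    obtain ⟨hle, heq⟩ := le_length_of_twoSidedLaplace_alternates A.toList hadm hnonneg hnz (2 * n) 1
      (fun i => u i / σ ^ 2) one_ne_zero (fun i hi => div_lt_div_of_pos_right (hu.1 i hi) hσ2)
      (fun i hi => by
        rcases Nat.even_or_odd' i with ⟨k, rfl | rfl⟩
        · simpa [pow_mul] using hin k (by omega)
        · simpa [pow_mul, pow_succ] using (hout k (by omega)).le)
      (fun i hi => by
        rcases Nat.even_or_odd' i with ⟨k, rfl | rfl⟩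
        · exact Or.inr (hout k (by omega)).ne
        · exact Or.inl (hout k (by omega)).ne)
    rw [Finset.length_toList] at hle heq
    obtain ⟨v, hv⟩ := exists_alternatesIn_nonneg (g := fun y => f y - t) hz hzsign hle fun h => by
      simpa [pow_mul] using heq h
    refine ⟨v, ?_⟩
    simpa [predictionSet] using hv
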